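/- All vocabularies consist of relation symbols of positive arity; $\mathcal T$ is the complete relational vocabulary, which has countably infinitely many $k$-ary relation symbols for every $k\ge 1$. Models have non-empty domains. For a vocabulary $\tau$ we consider the following logics. * $\mathrm{UF}_1(\tau)$, the (equality-free) uniform one-dimensional fragment, is the smallest set $\mathcal F$ of first-order $\tau$-formulas such that: (i) $\top,\bot\in\mathcal F$, and every relational atom in which exactly one variable occurs is in $\mathcal F$; (ii) $\mathcal F$ is closed under $\neg$ and $\wedge$; (iii) if $Y=\{y_1,\dots,y_k\}$ is a set of variables, $U$ is a finite set of formulas of $\mathcal F$ with all free variables in $Y$, $V\subseteq Y$, $F$ is a finite set of relational $\tau$-atoms each of which has exactly $V$ as its set of variables, and $\varphi$ is a Boolean combination of formulas in $U\cup F$, then $\exists y_2\cdots\exists y_k\,\varphi\in\mathcal F$; (iv) if $\varphi\in\mathcal F$, then $\exists y\,\varphi\in\mathcal F$. * $\mathrm{FOC}^2(\tau)$ is the set of formulas of first-order logic with equality and counting quantifiers $\exists^{\ge n}$ in which at most two distinct variables occur, free or bound; $\mathrm{FO}^2(\tau)$ is the set of formulas of $\mathrm{FOC}^2(\tau)$ without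 counting quantifiers. * $\mathrm{GNFO}(\tau)$, guarded negation first-order logic, is the smallest set of formulas that contains the relational atoms and the equalities $x=y$, is closed under $\wedge$, $\vee$ and $\exists x$, and contains $\alpha\wedge\neg\varphi$ whenever it contains $\varphi$ and $\alpha$ is a relational atom or an equality that contains all free variables of $\varphi$. A sentence is *expressible* in a logic if it is equivalent to a sentence of that logic, that is, the two are true in the same models. Two logics are *incomparable* in expressive power if each has a sentence that is not expressible in the other. **Theorem.** Over $\mathcal T$, $\mathrm{UF}_1$ is incomparable in expressive power with $\mathrm{FOC}^2$, and $\mathrm{UF}_1$ is incomparable in expressive power with $\mathrm{GNFO}$. More precisely, for every vocabulary $\tau$: 1. for every ternary $R\in\tau$, $\exists x\exists y\exists z\,R(x,y,z)$ is a $\mathrm{UF}_1(\tau)$-sentence that is not expressible in $\mathrm{FOC}^2(\tau)$; 2. for every binary $R\in\tau$, $\exists x\exists y\,\neg R(x,y)$ is a $\mathrm{UF}_1(\tau)$-sentence that is not expressible in $\mathrm{GNFO}(\tau)$; 3. $\forall x\forall y\,(x=y)$ is an $\mathrm{FO}^2(\tau)$-sentence that is not expressible in $\mathrm{UF}_1(\tau)$;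 4. for every binary $R\in\tau$, $\exists x\exists y\exists z\,\bigl(R(x,y)\wedge R(y,z)\wedge R(z,x)\bigr)$ is a $\mathrm{GNFO}(\tau)$-sentence that is not expressible in $\mathrm{UF}_1(\tau)$. -/

import Mathlib

/-- Formulas of first-order logic with equality and with counting quantifiers, over the relation
symbols of the vocabulary `L`. The variable symbols are the natural numbers. -/
inductive Fml (L : FirstOrder.Language.{0, 0}) : Type
  | top : Fml L
  | bot : Fml L
  | eq (x y : ℕ) : Fml L
  /-- The atom `R(v 0, …, v (k - 1))`. -/
  | rel {k : ℕ} (R : L.Relations k) (v : Fin k → ℕ) : Fml L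
  | neg (φ : Fml L) : Fml L
  | and (φ ψ : Fml L) : Fml L
  | or (φ ψ : Fml L) : Fml L
  /-- `∃ x φ` -/
  | ex (x : ℕ) (φ : Fml L) : Fml L
  /-- The counting quantifier `∃^{≥ n} x φ`. -/
  | exGE (n : ℕ) (x : ℕ) (φ : Fml L) : Fml L

namespace Fml

variable {L : FirstOrder.Language.{0, 0}}

/-- `∀ x φ` -/
def all (x : ℕ) (φ : Fml L) : Fml L := neg (ex x (neg φ))

/-- The block `∃ y₁ … ∃ yₘ φ`. -/
def exs (ys : List ℕ) (φ : Fml L) : Fml L := ys.foldr ex φ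

/-- The free variables of a formula. -/
def fv : Fml L → Set ℕ
  | top => ∅
  | bot => ∅
  | eq x y => {x, y}
  | rel _ v => Set.range v
  | neg φ => φ.fv
  | and φ ψ => φ.fv ∪ ψ.fv
  | or φ ψ => φ.fv ∪ ψ.fv
  | ex x φ => φ.fv \ {x}
  | exGE _ x φ => φ.fv \ {x}

/-- All variables that occur in a formula, free, bound or next to a quantifier. -/
def vars : Fml L → Set ℕ
  | top => ∅
  | bot => ∅
  | eq x y => {x, y}
  | rel _ v => Set.range v
  | neg φ => φ.vars
  | and φ ψ => φ.vars ∪ ψ.vars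
  | or φ ψ => φ.vars ∪ ψ.vars
  | ex x φ => insert x φ.vars
  | exGE _ x φ => insert x φ.vars

/-- Sentences are formulas without free variables. -/
def IsSentence (φ : Fml L) : Prop := φ.fv = ∅

/-- The formula contains no counting quantifier, that is, it is a formula of first-order logic. -/
def CountingFree : Fml L → Prop
  | top => True
  | bot => True
  | eq _ _ => True
  | rel _ _ => True
  | neg φ => φ.CountingFree
  | and φ ψ => φ.CountingFree ∧ ψ.CountingFree
  | or φ ψ => φ.CountingFree ∧ ψ.CountingFree
  | ex _ φ => φ.CountingFree
  | exGE _ _ _ => False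

/-- `φ.Sat f`: the formula `φ` holds in the model `M` under the assignment `f`. -/
def Sat {M : Type} [L.Structure M] : Fml L → (ℕ → M) → Prop
  | top, _ => True
  | bot, _ => False
  | eq x y, f => f x = f y
  | rel R v, f => FirstOrder.Language.Structure.RelMap R (fun i => f (v i))
  | neg φ, f => ¬ φ.Sat f
  | and φ ψ, f => φ.Sat f ∧ ψ.Sat f
  | or φ ψ, f => φ.Sat f ∨ ψ.Sat f
  | ex x φ, f => ∃ a : M, φ.Sat (Function.update f x a)
  | exGE n x φ, f => (n : ℕ∞) ≤ Set.encard {a : M | φ.Sat (Function.update f x a)}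

/-- Logical equivalence: the formulas hold in the same non-empty models under the same
assignments. -/
def Equivalent (φ ψ : Fml L) : Prop :=
  ∀ (M : Type) [Nonempty M] [L.Structure M] (f : ℕ → M), φ.Sat f ↔ ψ.Sat f

/-- Boolean combinations of formulas in the set `S`. -/
inductive BoolComb (S : Set (Fml L)) : Fml L → Prop
  | of {φ : Fml L} (h : φ ∈ S) : BoolComb S φ
  | top : BoolComb S top
  | bot : BoolComb S bot
  | neg {φ : Fml L} (h : BoolComb S φ) : BoolComb S (neg φ)
  | and {φ ψ : Fml L} (h₁ : BoolComb S φ) (h₂ : BoolComb S ψ) : BoolComb S (and φ ψ)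
  | or {φ ψ : Fml L} (h₁ : BoolComb S φ) (h₂ : BoolComb S ψ) : BoolComb S (or φ ψ)

/-- A `V`-atom is a relational atom whose set of variables is exactly `V`. -/
def IsAtomOn (V : Set ℕ) (φ : Fml L) : Prop :=
  ∃ (k : ℕ) (R : L.Relations k) (v : Fin k → ℕ), φ = rel R v ∧ Set.range v = V

/-- A `V`-uniform set is a finite set of `V`-atoms. -/
def IsUniformSet (V : Set ℕ) (F : Set (Fml L)) : Prop :=
  F.Finite ∧ ∀ φ ∈ F, IsAtomOn V φ

/-- The formulas of the uniform one-dimensional fragment. In `block`, the variables are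
`Y = {y₁, …, yₖ}`, given as `y₁` and the list `ys = [y₂, …, yₖ]`. -/
inductive IsUF1 : Fml L → Prop
  | unaryAtom {φ : Fml L} (x : ℕ) (h : IsAtomOn {x} φ) : IsUF1 φ
  | top : IsUF1 top
  | bot : IsUF1 bot
  | neg {φ : Fml L} (h : IsUF1 φ) : IsUF1 (neg φ)
  | and {φ ψ : Fml L} (h₁ : IsUF1 φ) (h₂ : IsUF1 ψ) : IsUF1 (and φ ψ)
  | block (y : ℕ) (ys : List ℕ) (U : Set (Fml L)) (hUfin : U.Finite)
      (hU : ∀ ψ ∈ U, IsUF1 ψ) (hUfv : ∀ ψ ∈ U, ψ.fv ⊆ {z | z ∈ y :: ys})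
      (V : Set ℕ) (hV : V ⊆ {z | z ∈ y :: ys})
      (F : Set (Fml L)) (hF : IsUniformSet V F)
      {φ : Fml L} (hφ : BoolComb (U ∪ F) φ) : IsUF1 (exs ys φ)
  | ex (y : ℕ) {φ : Fml L} (h : IsUF1 φ) : IsUF1 (ex y φ)

/-- Atomic formulas, including equalities. -/
def IsAtomic (φ : Fml L) : Prop :=
  (∃ x y : ℕ, φ = eq x y) ∨ ∃ (k : ℕ) (R : L.Relations k) (v : Fin k → ℕ), φ = rel R v

/-- The formulas of guarded negation first-order logic: a negation `¬ φ` occurs only as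
`α ∧ ¬ φ` with an atomic formula `α` that contains all free variables of `φ`. -/
inductive IsGNFO : Fml L → Prop
  | atomic {α : Fml L} (h : IsAtomic α) : IsGNFO α
  | and {φ ψ : Fml L} (h₁ : IsGNFO φ) (h₂ : IsGNFO ψ) : IsGNFO (and φ ψ)
  | or {φ ψ : Fml L} (h₁ : IsGNFO φ) (h₂ : IsGNFO ψ) : IsGNFO (or φ ψ)
  | ex (x : ℕ) {φ : Fml L} (h : IsGNFO φ) : IsGNFO (ex x φ)
  | guardedNeg {α φ : Fml L} (hα : IsAtomic α) (hφ : IsGNFO φ) (hfv : φ.fv ⊆ α.fv) :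
      IsGNFO (and α (neg φ))

end Fml

/-- The uniform one-dimensional fragment. -/
def UF1 (L : FirstOrder.Language.{0, 0}) : Set (Fml L) := {φ | φ.IsUF1}

/-- Guarded negation first-order logic. -/
def GNFO (L : FirstOrder.Language.{0, 0}) : Set (Fml L) := {φ | φ.IsGNFO}

/-- Two-variable logic with equality and counting quantifiers. -/
def FOC2 (L : FirstOrder.Language.{0, 0}) : Set (Fml L) := {φ | ∃ x y : ℕ, φ.vars ⊆ {x, y}}

/-- Two-variable first-order logic with equality. -/
def FO2 (L : FirstOrder.Language.{0, 0}) : Set (Fml L) :=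
  {φ | φ.CountingFree ∧ ∃ x y : ℕ, φ.vars ⊆ {x, y}}

/-- Some sentence of the logic `A` is equivalent to `φ`. -/
def ExpressibleIn {L : FirstOrder.Language.{0, 0}} (A : Set (Fml L)) (φ : Fml L) : Prop :=
  ∃ ψ ∈ A, ψ.IsSentence ∧ φ.Equivalent ψ

/-- Every sentence of the logic `A` is expressible in the logic `B`. -/
def ContainedIn {L : FirstOrder.Language.{0, 0}} (A B : Set (Fml L)) : Prop :=
  ∀ φ ∈ A, φ.IsSentence → ExpressibleIn B φ

/-- Neither logic is contained in the other with regard to expressive power. -/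
def Incomparable {L : FirstOrder.Language.{0, 0}} (A B : Set (Fml L)) : Prop :=
  ¬ ContainedIn A B ∧ ¬ ContainedIn B A

/-- The complete relational vocabulary: countably infinitely many `k`-ary relation symbols for each
positive `k`, and no other symbols. -/
def completeVocabulary : FirstOrder.Language.{0, 0} :=
  ⟨fun _ => Empty, fun k => {_i : ℕ // 0 < k}⟩

section Witnesses

variable {L : FirstOrder.Language.{0, 0}}

/-- `∃x ∃y ∃z R(x,y,z)` -/
def someTriple (R : L.Relations 3) : Fml L :=
  .ex 0 (.ex 1 (.ex 2 (.rel R ![0, 1, 2])))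

/-- `∃x ∃y ¬R(x,y)` -/
def someNonEdge (R : L.Relations 2) : Fml L :=
  .ex 0 (.ex 1 (.neg (.rel R ![0, 1])))

/-- `∀x ∀y (x = y)` -/
def atMostOneElement (L : FirstOrder.Language.{0, 0}) : Fml L :=
  .all 0 (.all 1 (.eq 0 1))

/-- `∃x ∃y ∃z (R(x,y) ∧ R(y,z) ∧ R(z,x))` -/
def triangle (R : L.Relations 2) : Fml L :=
  .ex 0 (.ex 1 (.ex 2
    (.and (.rel R ![0, 1]) (.and (.rel R ![1, 2]) (.rel R ![2, 0])))))

end Witnesses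

/-! Each non-expressibility claim comes from two models that the weaker logic cannot tell apart. Two
variables never see more than two elements at once, so on a three-element domain it does not matter
whether the tuples with three distinct entries are all related or none are
(`satIn_iff_of_vars_subset_pair`). In a diagonal structure a true guard makes its variables equal,
so guarded negation is only tested at constant assignments, where the size of the domain is
invisible (`IsGNFO.sat_diagonal`). For UF1, take irreflexive digraphs. All non-unary atoms of a
block share one variable set `V`, and they are false unless `V` is a pair. Without equality, a block
therefore observes just one pair of elements, and it suffices that the type of any pair can be
realised from any element of the other graph (`IsUF1.satIn_edgeStructure_iff`). This holds for
edgeless graphs of sizes 1 and 2, and for directed cycles of lengths 3 and 4. -/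

namespace Fml

variable {L : FirstOrder.Language.{0, 0}}

/-- The satisfaction relation with the structure given explicitly. -/
abbrev SatIn {M : Type} (S : L.Structure M) (φ : Fml L) (f : ℕ → M) : Prop := @Sat L M S φ f

/-- A formula that separates two models which no formula of `A` separates is not expressible
in `A`. -/
theorem not_expressibleIn {A : Set (Fml L)} {φ : Fml L} {M N : Type} (S : L.Structure M)
    (T : L.Structure N) (f : ℕ → M) (g : ℕ → N)
    (h : ∀ ψ ∈ A, SatIn S ψ f → SatIn T ψ g) (hf : SatIn S φ f) (hg : ¬ SatIn T φ g) :
    ¬ ExpressibleIn A φ := by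
  rintro ⟨ψ, hψ, -, he⟩
  exact hg ((@he N ⟨g 0⟩ T g).2 (h ψ hψ ((@he M ⟨f 0⟩ S f).1 hf)))

/-- Satisfaction depends only on the values of the free variables. -/
theorem sat_congr {M : Type} [L.Structure M] {φ : Fml L} {f g : ℕ → M}
    (h : ∀ x ∈ φ.fv, f x = g x) : φ.Sat f ↔ φ.Sat g := by
  induction φ generalizing f g with
  | top => rfl
  | bot => rfl
  | eq x y => simp [Sat, h x (by simp [fv]), h y (by simp [fv])]
  | rel R v =>
    have : (fun i => f (v i)) = fun i => g (v i) := funext fun i => h _ ⟨i, rfl⟩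
    simp [Sat, this]
  | neg φ ih => exact not_congr (ih h)
  | and φ ψ ih₁ ih₂ =>
    exact and_congr (ih₁ fun x hx => h x (.inl hx)) (ih₂ fun x hx => h x (.inr hx))
  | or φ ψ ih₁ ih₂ =>
    exact or_congr (ih₁ fun x hx => h x (.inl hx)) (ih₂ fun x hx => h x (.inr hx))
  | ex x φ ih =>
    refine exists_congr fun a => ih fun z hz => ?_
    by_cases hzx : z = x
    · simp [hzx]
    · simpa [hzx] using h z ⟨hz, hzx⟩
  | exGE n x φ ih =>
    have : {a : M | φ.Sat (Function.update f x a)} = {a : M | φ.Sat (Function.update g x a)} := by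
      ext a
      refine ih fun z hz => ?_
      by_cases hzx : z = x
      · simp [hzx]
      · simpa [hzx] using h z ⟨hz, hzx⟩
    simp only [Sat, this]

/-! ### Two-variable logic with counting -/

/-- Two structures on the same domain that agree on all tuples with at most two distinct entries
satisfy the same two-variable formulas with counting. -/
theorem satIn_iff_of_vars_subset_pair {M : Type} (S T : L.Structure M)
    (h : ∀ {k : ℕ} (R : L.Relations k) (v : Fin k → M), (∃ a b, Set.range v ⊆ {a, b}) →
      (S.RelMap R v ↔ T.RelMap R v))
    {x y : ℕ} {φ : Fml L} (hφ : φ.vars ⊆ {x, y}) (f : ℕ → M) : SatIn S φ f ↔ SatIn T φ f := by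
  induction φ generalizing f with
  | top => rfl
  | bot => rfl
  | eq x y => rfl
  | rel R v =>
    refine h R _ ⟨f x, f y, ?_⟩
    rintro _ ⟨i, rfl⟩
    rcases hφ ⟨i, rfl⟩ with hi | hi
    · exact .inl (congrArg f hi)
    · exact .inr (congrArg f hi)
  | neg φ ih => exact not_congr (ih hφ f)
  | and φ ψ ih₁ ih₂ =>
    exact and_congr (ih₁ (Set.union_subset_iff.1 hφ).1 f) (ih₂ (Set.union_subset_iff.1 hφ).2 f)
  | or φ ψ ih₁ ih₂ =>
    exact or_congr (ih₁ (Set.union_subset_iff.1 hφ).1 f) (ih₂ (Set.union_subset_iff.1 hφ).2 f)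
  | ex x φ ih => exact exists_congr fun a => ih (Set.insert_subset_iff.1 hφ).2 _
  | exGE n x φ ih =>
    have : {a : M | SatIn S φ (Function.update f x a)} =
        {a : M | SatIn T φ (Function.update f x a)} :=
      Set.ext fun a => ih (Set.insert_subset_iff.1 hφ).2 _
    exact iff_of_eq (congrArg (fun s : Set M => (n : ℕ∞) ≤ s.encard) this)

/-- The relational structure in which every relation symbol of arity `k` denotes `P k`. -/
abbrev uniformStructure (L : FirstOrder.Language.{0, 0}) [L.IsRelational] {M : Type}
    (P : ∀ k : ℕ, (Fin k → M) → Prop) : L.Structure M where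
  funMap F := isEmptyElim F
  RelMap {k} _ v := P k v

/-- The structure in which exactly the constant tuples are related. -/
abbrev diagonalStructure (L : FirstOrder.Language.{0, 0}) [L.IsRelational] (M : Type) :
    L.Structure M :=
  uniformStructure L fun _ v => ∀ i j, v i = v j

/-- The structure in which the binary relation symbols denote `E` and the others are empty. -/
abbrev edgeStructure (L : FirstOrder.Language.{0, 0}) [L.IsRelational] {M : Type}
    (E : M → M → Prop) : L.Structure M :=
  uniformStructure L fun k v => ∃ h : k = 2, E (v (Fin.cast h.symm 0)) (v (Fin.cast h.symm 1))

/-! ### Guarded negation on diagonal structures -/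

/-- In a diagonal structure, a satisfied atom identifies all of its variables. -/
theorem IsAtomic.eq_of_sat_diagonal [L.IsRelational] {M : Type} {α : Fml L} (hα : α.IsAtomic)
    {f : ℕ → M} (h : SatIn (diagonalStructure L M) α f) {x y : ℕ} (hx : x ∈ α.fv)
    (hy : y ∈ α.fv) : f x = f y := by
  rcases hα with ⟨a, b, rfl⟩ | ⟨k, R, v, rfl⟩
  · have h : f a = f b := h
    rcases hx with rfl | rfl <;> rcases hy with rfl | rfl <;> simp [h]
  · obtain ⟨i, rfl⟩ := hx
    obtain ⟨j, rfl⟩ := hy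
    exact h i j

theorem IsAtomic.sat_diagonal_const [L.IsRelational] {M : Type} {α : Fml L} (hα : α.IsAtomic)
    (a : M) : SatIn (diagonalStructure L M) α fun _ => a := by
  rcases hα with ⟨x, y, rfl⟩ | ⟨k, R, v, rfl⟩
  · exact rfl
  · exact fun i j => rfl

/-- Guarded negation first-order logic does not distinguish diagonal structures. -/
theorem IsGNFO.sat_diagonal [L.IsRelational] {φ : Fml L} (hφ : φ.IsGNFO) {M N : Type} :
    ((∃ f, SatIn (diagonalStructure L M) φ f) →
      ∀ b : N, SatIn (diagonalStructure L N) φ fun _ => b) ∧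
    ((∃ f, SatIn (diagonalStructure L N) φ f) →
      ∀ b : M, SatIn (diagonalStructure L M) φ fun _ => b) := by
  induction hφ with
  | atomic h => exact ⟨fun _ => h.sat_diagonal_const, fun _ => h.sat_diagonal_const⟩
  | and _ _ ih₁ ih₂ =>
    exact ⟨fun ⟨f, h⟩ b => ⟨ih₁.1 ⟨f, h.1⟩ b, ih₂.1 ⟨f, h.2⟩ b⟩,
      fun ⟨f, h⟩ b => ⟨ih₁.2 ⟨f, h.1⟩ b, ih₂.2 ⟨f, h.2⟩ b⟩⟩
  | or _ _ ih₁ ih₂ =>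
    exact ⟨fun ⟨f, h⟩ b => h.imp (fun h => ih₁.1 ⟨f, h⟩ b) (fun h => ih₂.1 ⟨f, h⟩ b),
      fun ⟨f, h⟩ b => h.imp (fun h => ih₁.2 ⟨f, h⟩ b) (fun h => ih₂.2 ⟨f, h⟩ b)⟩
  | ex x _ ih =>
    -- Choosing `b` itself as witness keeps the assignment constant.
    refine ⟨fun ⟨f, a, h⟩ b => ⟨b, ?_⟩, fun ⟨f, a, h⟩ b => ⟨b, ?_⟩⟩ <;>
      rw [Function.update_eq_self_iff.2 rfl]
    exacts [ih.1 ⟨_, h⟩ b, ih.2 ⟨_, h⟩ b]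
  | @guardedNeg α φ hα _ hfv ih =>
    have key : ∀ {K : Type} (f : ℕ → K), SatIn (diagonalStructure L K) α f →
        ∀ x ∈ φ.fv, ∀ y ∈ φ.fv, f x = f y := fun f h x hx y hy =>
      hα.eq_of_sat_diagonal h (hfv hx) (hfv hy)
    -- Under a true guard, `φ` sees only one value `c`; if `φ` is a sentence, any `c` will do.
    have key' : ∀ {K : Type} (f : ℕ → K), SatIn (diagonalStructure L K) α f →
        ∃ c, SatIn (diagonalStructure L K) φ (fun _ => c) → SatIn (diagonalStructure L K) φ f := by
      intro K f h
      rcases φ.fv.eq_empty_or_nonempty with he | ⟨y, hy⟩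
      · exact ⟨f 0, (@sat_congr _ _ (diagonalStructure L K) _ _ _ (by simp [he])).1⟩
      · exact ⟨f y, (@sat_congr _ _ (diagonalStructure L K) _ _ _
          fun x hx => key f h y hy x hx).1⟩
    constructor
    · rintro ⟨f, h₁, h₂⟩ b
      obtain ⟨c, hc⟩ := key' f h₁
      -- Negation reverses the direction of transfer, which is why both directions are proved
      -- together.
      exact ⟨hα.sat_diagonal_const b, fun h => h₂ (hc (ih.2 ⟨_, h⟩ c))⟩
    · rintro ⟨f, h₁, h₂⟩ b
      obtain ⟨c, hc⟩ := key' f h₁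
      exact ⟨hα.sat_diagonal_const b, fun h => h₂ (hc (ih.1 ⟨_, h⟩ c))⟩

/-! ### The uniform one-dimensional fragment on digraphs -/

theorem sat_exs_iff {M : Type} [L.Structure M] (ys : List ℕ) (φ : Fml L) (f : ℕ → M) :
    (exs ys φ).Sat f ↔ ∃ g : ℕ → M, (∀ z ∉ ys, g z = f z) ∧ φ.Sat g := by
  induction ys generalizing f with
  | nil =>
    refine ⟨fun h => ⟨f, fun _ _ => rfl, h⟩, ?_⟩
    rintro ⟨g, hg, h⟩
    rwa [funext fun z => hg z List.not_mem_nil] at h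
  | cons y ys ih =>
    change (∃ a, (exs ys φ).Sat (Function.update f y a)) ↔ _
    simp only [ih]
    constructor
    · rintro ⟨a, g, hg, h⟩
      refine ⟨g, fun z hz => ?_, h⟩
      rw [List.mem_cons, not_or] at hz
      rw [hg z hz.2, Function.update_of_ne hz.1]
    · rintro ⟨g, hg, h⟩
      refine ⟨g y, g, fun z hz => ?_, h⟩
      by_cases hzy : z = y
      · simp [hzy]
      · rw [Function.update_of_ne hzy, hg z (by simp [hzy, hz])]

theorem BoolComb.satIn_iff {X : Set (Fml L)} {φ : Fml L} (hφ : BoolComb X φ) {M N : Type}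
    {S : L.Structure M} {T : L.Structure N} {f : ℕ → M} {g : ℕ → N}
    (h : ∀ ψ ∈ X, SatIn S ψ f ↔ SatIn T ψ g) : SatIn S φ f ↔ SatIn T φ g := by
  induction hφ with
  | of hψ => exact h _ hψ
  | top => rfl
  | bot => rfl
  | neg _ ih => exact not_congr ih
  | and _ _ ih₁ ih₂ => exact and_congr ih₁ ih₂
  | or _ _ ih₁ ih₂ => exact or_congr ih₁ ih₂

/-- The realisation of the type of a pair in `E` extends any given element of `E'`. -/
def PairExtension {M N : Type} (E : M → M → Prop) (E' : N → N → Prop) : Prop :=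
  ∀ (a b : M) (c : N), ∃ d : N, (E a b ↔ E' c d) ∧ (E b a ↔ E' d c)

/-- In an irreflexive edge structure, a satisfied atom has exactly two variables. -/
theorem IsAtomOn.exists_pair_of_sat [L.IsRelational] {M : Type} {E : M → M → Prop}
    (hE : ∀ a, ¬ E a a) {V : Set ℕ} {φ : Fml L} (hφ : IsAtomOn V φ) {f : ℕ → M}
    (h : SatIn (edgeStructure L E) φ f) : ∃ u w, u ≠ w ∧ V = {u, w} := by
  obtain ⟨k, R, v, rfl, rfl⟩ := hφ
  obtain ⟨rfl, h⟩ := h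
  refine ⟨v 0, v 1, fun he => ?_, ?_⟩
  · exact hE (f (v 0)) (by simpa [← he] using h)
  · ext z
    simp [Fin.exists_fin_two, eq_comm]

/-- A binary atom on `{u, w}` asks about an edge between them or about a loop, and loops are absent
on both sides. The case `u = w` is allowed and covers unary atoms. -/
theorem IsAtomOn.satIn_edgeStructure_iff [L.IsRelational] {M N : Type} {E : M → M → Prop}
    {E' : N → N → Prop} (hE : ∀ a, ¬ E a a) (hE' : ∀ a, ¬ E' a a) {u w : ℕ} {φ : Fml L}
    (hφ : IsAtomOn {u, w} φ) {f : ℕ → M} {g : ℕ → N} (h₁ : E (f u) (f w) ↔ E' (g u) (g w))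
    (h₂ : E (f w) (f u) ↔ E' (g w) (g u)) :
    SatIn (edgeStructure L E) φ f ↔ SatIn (edgeStructure L E') φ g := by
  obtain ⟨k, R, v, rfl, hv⟩ := hφ
  refine exists_congr fun hk => ?_
  subst hk
  have hm : ∀ i, v i = u ∨ v i = w := fun i => hv.subset ⟨i, rfl⟩
  change E (f (v 0)) (f (v 1)) ↔ E' (g (v 0)) (g (v 1))
  rcases hm 0 with h | h <;> rcases hm 1 with h' | h' <;> simp [h, h', h₁, h₂, hE, hE']

/-- One direction of the induction step for a block of quantifiers. -/
theorem exists_assignment_of_pairExtension [L.IsRelational] {M N : Type} {E : M → M → Prop}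
    {E' : N → N → Prop} (hE : ∀ a, ¬ E a a) (hE' : ∀ a, ¬ E' a a) (hext : PairExtension E E')
    {y : ℕ} {ys : List ℕ} {V : Set ℕ} (hV : V ⊆ {z | z ∈ y :: ys}) (f : ℕ → M) (g : ℕ → N) :
    ∃ g' : ℕ → N, (∀ z ∉ ys, g' z = g z) ∧ ∀ φ : Fml L, IsAtomOn V φ →
      (SatIn (edgeStructure L E) φ f ↔ SatIn (edgeStructure L E') φ g') := by
  by_cases hp : ∃ u w, u ≠ w ∧ V = {u, w}
  -- At most one member of the pair is the possibly free variable `y`; the other one is called `w`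
  -- and is quantified.
  · obtain ⟨u, w, huw, hwy, rfl⟩ : ∃ u w, u ≠ w ∧ w ≠ y ∧ V = {u, w} := by
      obtain ⟨u, w, huw, rfl⟩ := hp
      by_cases hwy : w = y
      · exact ⟨w, u, huw.symm, fun h => huw (h.trans hwy.symm), Set.pair_comm u w⟩
      · exact ⟨u, w, huw, hwy, rfl⟩
    obtain ⟨d, h₁, h₂⟩ := hext (f u) (f w) (g y)
    have hw : w ∈ ys := (List.mem_cons.1 (hV (by simp : w ∈ ({u, w} : Set ℕ)))).resolve_left hwy
    have hu : u = y ∨ u ∈ ys := List.mem_cons.1 (hV (by simp : u ∈ ({u, w} : Set ℕ)))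
    -- Whether `u` is `y` or a quantified variable, it gets the value `g y`, from which `d`
    -- completes the pair. The remaining variables do not occur in any `V`-atom.
    refine ⟨fun z => if z = w then d else if z ∈ ys then g y else g z, fun z hz => ?_,
      fun φ hφ => ?_⟩
    · have : z ≠ w := fun h => hz (h ▸ hw)
      simp [this, hz]
    · have hgu : (if u ∈ ys then g y else g u) = g y := by
        rcases hu with rfl | hu
        · simp
        · simp [hu]
      exact hφ.satIn_edgeStructure_iff hE hE' (by simpa [huw, hgu] using h₁)
        (by simpa [huw, hgu] using h₂)
  · exact ⟨g, fun _ _ => rfl, fun φ hφ =>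
      iff_of_false (fun h => hp (hφ.exists_pair_of_sat hE h))
        (fun h => hp (hφ.exists_pair_of_sat hE' h))⟩

/-- Irreflexive edge structures with the pair extension property in both directions satisfy the
same formulas of the uniform one-dimensional fragment, under arbitrary assignments. -/
theorem IsUF1.satIn_edgeStructure_iff [L.IsRelational] {φ : Fml L} (hφ : φ.IsUF1) {M N : Type}
    {E : M → M → Prop} {E' : N → N → Prop} (hE : ∀ a, ¬ E a a) (hE' : ∀ a, ¬ E' a a)
    (hext : PairExtension E E') (hext' : PairExtension E' E) (f : ℕ → M) (g : ℕ → N) :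
    SatIn (edgeStructure L E) φ f ↔ SatIn (edgeStructure L E') φ g := by
  induction hφ generalizing f g with
  | unaryAtom x h =>
    rw [← Set.pair_eq_singleton] at h
    exact h.satIn_edgeStructure_iff hE hE' (by simp [hE, hE']) (by simp [hE, hE'])
  | top => rfl
  | bot => rfl
  | neg _ ih => exact not_congr (ih f g)
  | and _ _ ih₁ ih₂ => exact and_congr (ih₁ f g) (ih₂ f g)
  | block y ys U _ _ _ V hV F hF hφ ih =>
    refine (@sat_exs_iff _ _ (edgeStructure L E) ys _ f).trans
      (Iff.trans ?_ (@sat_exs_iff _ _ (edgeStructure L E') ys _ g).symm)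
    constructor
    · rintro ⟨f', -, h⟩
      obtain ⟨g', hg', hiff⟩ :=
        exists_assignment_of_pairExtension (L := L) hE hE' hext hV f' g
      refine ⟨g', hg', (hφ.satIn_iff fun ψ hψ => ?_).1 h⟩
      -- Members of `U` agree under arbitrary assignments, so only the `V`-atoms constrain `g'`.
      exact hψ.elim (fun hψ => ih ψ hψ f' g') (fun hψ => hiff ψ (hF.2 ψ hψ))
    · rintro ⟨g', -, h⟩
      obtain ⟨f', hf', hiff⟩ :=
        exists_assignment_of_pairExtension (L := L) hE' hE hext' hV g' f
      refine ⟨f', hf', (hφ.satIn_iff fun ψ hψ => ?_).2 h⟩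
      exact hψ.elim (fun hψ => ih ψ hψ f' g') (fun hψ => (hiff ψ (hF.2 ψ hψ)).symm)
  | ex y _ ih =>
    -- Any element serves as witness; `g 0` and `f 0` merely supply one.
    exact ⟨fun ⟨_, h⟩ => ⟨g 0, (ih _ _).1 h⟩, fun ⟨_, h⟩ => ⟨f 0, (ih _ _).2 h⟩⟩

end Fml

open Fml

/-! ### The four separating sentences -/

section

variable {L : FirstOrder.Language.{0, 0}}

theorem someTriple_mem_UF1 (R : L.Relations 3) : someTriple R ∈ UF1 L := by
  -- A block leaves its first variable unquantified, so the outermost quantifier comes from the rule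
  -- for a single `∃`.
  refine .ex 0 (.block 0 [1, 2] ∅ Set.finite_empty (by simp) (by simp) {0, 1, 2} ?_
    {.rel R ![0, 1, 2]} ⟨Set.finite_singleton _, ?_⟩ (.of (.inr rfl)))
  · intro z hz
    simpa using hz
  · rintro _ rfl
    exact ⟨3, R, _, rfl, by ext z; simp; tauto⟩

theorem someTriple_isSentence (R : L.Relations 3) : (someTriple R).IsSentence := by
  simp only [someTriple, IsSentence, fv]
  ext z
  simp

theorem someTriple_not_expressibleIn_FOC2 [L.IsRelational] (R : L.Relations 3) :
    ¬ ExpressibleIn (FOC2 L) (someTriple R) := by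
  refine not_expressibleIn
    (uniformStructure L fun _ v => ∀ a b : Fin 3, ¬ Set.range v ⊆ {a, b})
    (uniformStructure L fun _ (_ : Fin _ → Fin 3) => False) (fun _ => 0) (fun _ => 0) ?_ ?_ ?_
  · rintro ψ ⟨x, y, hψ⟩
    exact (satIn_iff_of_vars_subset_pair (uniformStructure L _) (uniformStructure L _)
      (fun R v ⟨a, b, h⟩ => iff_of_false (fun h' => h' a b h) id) hψ _).1
  · refine ⟨0, 1, 2, fun a b h => ?_⟩
    have h0 := h ⟨0, rfl⟩
    have h1 := h ⟨1, rfl⟩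
    have h2 := h ⟨2, rfl⟩
    simp [Function.update] at h0 h1 h2
    clear h
    revert a b
    decide
  · rintro ⟨a, b, c, h⟩
    exact h

theorem someNonEdge_mem_UF1 (R : L.Relations 2) : someNonEdge R ∈ UF1 L := by
  refine .ex 0 (.block 0 [1] ∅ Set.finite_empty (by simp) (by simp) {0, 1} ?_
    {.rel R ![0, 1]} ⟨Set.finite_singleton _, ?_⟩ (.neg (.of (.inr rfl))))
  · intro z hz
    simpa using hz
  · rintro _ rfl
    exact ⟨2, R, _, rfl, by ext z; simp; tauto⟩

theorem someNonEdge_isSentence (R : L.Relations 2) : (someNonEdge R).IsSentence := by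
  simp only [someNonEdge, IsSentence, fv]
  ext z
  simp

theorem someNonEdge_not_expressibleIn_GNFO [L.IsRelational] (R : L.Relations 2) :
    ¬ ExpressibleIn (GNFO L) (someNonEdge R) := by
  refine not_expressibleIn (diagonalStructure L Bool) (diagonalStructure L Unit)
    (fun _ => true) (fun _ => ()) (fun ψ hψ h => (IsGNFO.sat_diagonal hψ).1 ⟨_, h⟩ ()) ?_ ?_
  · exact ⟨true, false, fun h => Bool.noConfusion (h 0 1)⟩
  · rintro ⟨a, b, h⟩
    exact h fun i j => rfl

theorem FO2_subset_FOC2 : FO2 L ⊆ FOC2 L := fun _ h => h.2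

theorem atMostOneElement_mem_FO2 : atMostOneElement L ∈ FO2 L := by
  refine ⟨trivial, 0, 1, ?_⟩
  simp [atMostOneElement, Fml.all, vars]

theorem atMostOneElement_isSentence : (atMostOneElement L).IsSentence := by
  simp only [atMostOneElement, IsSentence, Fml.all, fv]
  ext z
  simp

theorem atMostOneElement_not_expressibleIn_UF1 [L.IsRelational] :
    ¬ ExpressibleIn (UF1 L) (atMostOneElement L) := by
  refine not_expressibleIn (edgeStructure L fun _ _ : Unit => False)
    (edgeStructure L fun _ _ : Bool => False) (fun _ => ()) (fun _ => true)
    (fun ψ hψ => (IsUF1.satIn_edgeStructure_iff hψ (by simp) (by simp) ?_ ?_ _ _).1) ?_ ?_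
  · exact fun _ _ c => ⟨c, Iff.rfl, Iff.rfl⟩
  · exact fun _ _ c => ⟨c, Iff.rfl, Iff.rfl⟩
  · rintro ⟨a, h⟩
    exact h fun ⟨b, hb⟩ => hb rfl
  · exact fun h => h ⟨true, fun h' => h' ⟨false, fun e => Bool.noConfusion e⟩⟩

theorem triangle_mem_GNFO (R : L.Relations 2) : triangle R ∈ GNFO L := by
  have h : ∀ v : Fin 2 → ℕ, IsGNFO (.rel R v) := fun v => .atomic (.inr ⟨2, R, v, rfl⟩)
  exact .ex 0 (.ex 1 (.ex 2 (.and (h _) (.and (h _) (h _)))))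

theorem triangle_isSentence (R : L.Relations 2) : (triangle R).IsSentence := by
  simp only [triangle, IsSentence, fv]
  ext z
  simp

theorem triangle_not_expressibleIn_UF1 [L.IsRelational] (R : L.Relations 2) :
    ¬ ExpressibleIn (UF1 L) (triangle R) := by
  -- In both directed cycles every vertex has a successor, a predecessor and a vertex not adjacent
  -- to it (itself), and no edge is symmetric; these are all the pair types.
  refine not_expressibleIn (edgeStructure L fun a b : Fin 3 => a + 1 = b)
    (edgeStructure L fun a b : Fin 4 => a + 1 = b) (fun _ => 0) (fun _ => 0)
    (fun ψ hψ => (IsUF1.satIn_edgeStructure_iff hψ (by decide) (by decide)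
      (by unfold PairExtension; decide) (by unfold PairExtension; decide) _ _).1) ?_ ?_
  · exact ⟨0, 1, 2, ⟨rfl, rfl⟩, ⟨rfl, rfl⟩, ⟨rfl, rfl⟩⟩
  · rintro ⟨a, b, c, ⟨_, h₁⟩, ⟨_, h₂⟩, ⟨_, h₃⟩⟩
    have key : ∀ a b c : Fin 4, a + 1 = b → b + 1 = c → c + 1 ≠ a := by decide
    exact key a b c h₁ h₂ h₃

end

instance : completeVocabulary.IsRelational := fun _ => inferInstanceAs (IsEmpty Empty)

theorem mainTheorem4 :
    -- incomparability over the complete relational vocabulary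
    (Incomparable (UF1 completeVocabulary) (FOC2 completeVocabulary) ∧
      Incomparable (UF1 completeVocabulary) (GNFO completeVocabulary)) ∧
    -- the four witnesses, over every relational vocabulary that has the relation symbol in question
    (∀ (L : FirstOrder.Language.{0, 0}) [L.IsRelational] [IsEmpty (L.Relations 0)],
      (∀ R : L.Relations 3,
        someTriple R ∈ UF1 L ∧ (someTriple R).IsSentence ∧
          ¬ ExpressibleIn (FOC2 L) (someTriple R)) ∧
      (∀ R : L.Relations 2,
        someNonEdge R ∈ UF1 L ∧ (someNonEdge R).IsSentence ∧
          ¬ ExpressibleIn (GNFO L) (someNonEdge R)) ∧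
      (atMostOneElement L ∈ FO2 L ∧ (atMostOneElement L).IsSentence ∧
        ¬ ExpressibleIn (UF1 L) (atMostOneElement L)) ∧
      (∀ R : L.Relations 2,
        triangle R ∈ GNFO L ∧ (triangle R).IsSentence ∧
          ¬ ExpressibleIn (UF1 L) (triangle R))) := by
  refine ⟨⟨⟨fun h => ?_, fun h => ?_⟩, ⟨fun h => ?_, fun h => ?_⟩⟩, fun L _ _ => ⟨fun R => ?_,
    fun R => ?_, ?_, fun R => ?_⟩⟩
  · let R : completeVocabulary.Relations 3 := ⟨0, by decide⟩
    exact someTriple_not_expressibleIn_FOC2 R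
      (h _ (someTriple_mem_UF1 R) (someTriple_isSentence R))
  · exact atMostOneElement_not_expressibleIn_UF1
      (h _ (FO2_subset_FOC2 atMostOneElement_mem_FO2) atMostOneElement_isSentence)
  · let R : completeVocabulary.Relations 2 := ⟨0, by decide⟩
    exact someNonEdge_not_expressibleIn_GNFO R
      (h _ (someNonEdge_mem_UF1 R) (someNonEdge_isSentence R))
  · let R : completeVocabulary.Relations 2 := ⟨0, by decide⟩
    exact triangle_not_expressibleIn_UF1 R (h _ (triangle_mem_GNFO R) (triangle_isSentence R))
  · exact ⟨someTriple_mem_UF1 R, someTriple_isSentence R, someTriple_not_expressibleIn_FOC2 R⟩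
  · exact ⟨someNonEdge_mem_UF1 R, someNonEdge_isSentence R, someNonEdge_not_expressibleIn_GNFO R⟩
  · exact ⟨atMostOneElement_mem_FO2, atMostOneElement_isSentence,
      atMostOneElement_not_expressibleIn_UF1⟩
  · exact ⟨triangle_mem_GNFO R, triangle_isSentence R, triangle_not_expressibleIn_UF1 R⟩
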